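/- Let $\mathbf L^{2,2}$ be $\mathbb R^4$ with an inner product $\langle\cdot,\cdot\rangle$ of signature $(+,+,-,-)$, and let $\mathbf H^{2,1}=\{\mathbf x\in\mathbf L^{2,2}:\langle\mathbf x,\mathbf x\rangle=-1\}$ with the induced Lorentzian metric. The mean curvature of a timelike surface (one with induced metric of signature $(+,-)$) with respect to a unit normal is half the trace of the corresponding second fundamental form with respect to the induced metric. **Theorem.** Let $U\subset\mathbb R^2$ be open, let $r>0$, and let $\mathbf x,\bar{\mathbf x}:U\to\mathbf H^{2,1}$ be two smooth timelike immersions with unit normal vectors $e_3$ and $\bar e_3$ respectively. Suppose that: (i) for each $p\in U$ there is a spacelike geodesic $\gamma_p$ of $\mathbf H^{2,1}$, parametrized by arc length, with $\gamma_p(0)=\mathbf x(p)$ and $\gamma_p(r)=\bar{\mathbf x}(p)$; (ii) for each $p\in U$, the unit tangent vectors $\gamma_p'(0)$ and $\gamma_p'(r)$ project orthogonally to null (nonzero lightlike) vectors $N(p)$ and $\bar N(p)$ in the tangent planes at $p$ of the surfaces $\mathbf x$ and $\bar{\mathbf x}$ respectively. Let $\varepsilon,\bar\varepsilon\in\{1,-1\}$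 be the signs of $\langle\gamma_p'(0),e_3(p)\rangle$ and $\langle\gamma_p'(r),\bar e_3(p)\rangle$ (which are nonzero by (ii)); the normals are assumed to be chosen so that these signs do not depend on $p\in U$. Suppose further that: (iii) there is a constant $h\neq0$ such that, for each $p\in U$, the parallel transport of $e_3(p)$ along $\gamma_p$ from $\mathbf x(p)$ to $\bar{\mathbf x}(p)$ has inner product $h\cosh r$ with the null vector $\varepsilon\bar N(p)$, the projection of the unit tangent $\varepsilon\gamma_p'(r)$. Then both surfaces have constant mean curvature $H=\pm\dfrac{2-h}{2\tanh r}$. More precisely, the mean curvature of $\mathbf x$ with respect to $e_3$ is $\varepsilon\,\dfrac{2-h}{2\tanh r}$, and that of $\bar{\mathbf x}$ with respect to $\bar e_3$ is $-\bar\varepsilon\,\dfrac{2-h}{2\tanh r}$. -/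

import Mathlib

open scoped ContDiff

namespace AntiDeSitter

noncomputable section

/-- The vector space underlying the pseudo-Euclidean space `L^{2,2}`. -/
abbrev L22 : Type := Fin 4 → ℝ

/-- The inner product of signature `(+,+,-,-)` on `L22`. -/
def dot (a b : L22) : ℝ := a 0 * b 0 + a 1 * b 1 - a 2 * b 2 - a 3 * b 3

/-- The quadric `H^{2,1}` of all `x` with `⟨x, x⟩ = -1`. -/
def H21 : Set L22 := {x | dot x x = -1}

/-- A null (lightlike) vector: nonzero, with vanishing square. -/
def IsNull (v : L22) : Prop := v ≠ 0 ∧ dot v v = 0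

/-! ### Geodesics and parallel transport in `H^{2,1}` -/

/-- The Levi-Civita covariant derivative in `H^{2,1}` of a vector field `V` along a curve `γ`: the
orthogonal projection of `V'(t)` to the tangent space at `γ t`, which is the orthogonal complement
of `γ t`; recall `⟨γ t, γ t⟩ = -1`. -/
def covDeriv (γ V : ℝ → L22) (t : ℝ) : L22 :=
  deriv V t + dot (deriv V t) (γ t) • γ t

/-- `V` is a smooth parallel tangent vector field of `H^{2,1}` along the curve `γ`. -/
structure IsParallelAlong (γ V : ℝ → L22) : Prop where
  smooth : ContDiff ℝ ∞ V
  tangent : ∀ t, dot (V t) (γ t) = 0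
  parallel : ∀ t, covDeriv γ V t = 0

/-- `γ` is a spacelike geodesic of `H^{2,1}`, parametrized by arc length. -/
structure IsSpacelikeGeodesic (γ : ℝ → L22) : Prop where
  smooth : ContDiff ℝ ∞ γ
  mem : ∀ t, γ t ∈ H21
  unit_speed : ∀ t, dot (deriv γ t) (deriv γ t) = 1
  geodesic : ∀ t, covDeriv γ (deriv γ) t = 0

/-- `w` is the parallel transport of `v` along `γ`, from parameter `a` to parameter `b`. -/
def IsParallelTransport (γ : ℝ → L22) (a b : ℝ) (v w : L22) : Prop :=
  ∃ V : ℝ → L22, IsParallelAlong γ V ∧ V a = v ∧ V b = w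

/-! ### Timelike surfaces in `H^{2,1}` -/

/-- `x` restricts to a smooth timelike immersion of the open set `U` into `H^{2,1}`: the metric
induced on each (two-dimensional) tangent plane has signature `(+,-)`. -/
structure IsTimelikeImmersion (U : Set (ℝ × ℝ)) (x : ℝ × ℝ → L22) : Prop where
  smooth : ContDiffOn ℝ ∞ x U
  mem : ∀ p ∈ U, x p ∈ H21
  immersion : ∀ p ∈ U, Function.Injective (fderiv ℝ x p)
  exists_pos : ∀ p ∈ U, ∃ u, 0 < dot (fderiv ℝ x p u) (fderiv ℝ x p u)
  exists_neg : ∀ p ∈ U, ∃ u, dot (fderiv ℝ x p u) (fderiv ℝ x p u) < 0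

/-- The tangent plane of the surface `x` at the parameter value `p`. -/
def tangentPlane (x : ℝ × ℝ → L22) (p : ℝ × ℝ) : Submodule ℝ L22 :=
  LinearMap.range (fderiv ℝ x p : ℝ × ℝ →ₗ[ℝ] L22)

/-- `n` is a unit normal vector, within `H^{2,1}`, of the surface `x` at `p`. -/
structure IsUnitNormal (x : ℝ × ℝ → L22) (p : ℝ × ℝ) (n : L22) : Prop where
  tangent : dot n (x p) = 0
  normal : ∀ w ∈ tangentPlane x p, dot n w = 0
  unit : dot n n = 1

/-- `w` is the orthogonal projection of `v` to the subspace `P`. -/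
def IsOrthProj (P : Submodule ℝ L22) (v w : L22) : Prop :=
  w ∈ P ∧ ∀ u ∈ P, dot (v - w) u = 0

/-- The coordinate vectors of the parameter plane. -/
def coordVec : Fin 2 → ℝ × ℝ := ![(1, 0), (0, 1)]

/-- The matrix of the first fundamental form in the coordinates of the parameter plane. -/
def firstForm (x : ℝ × ℝ → L22) (p : ℝ × ℝ) : Matrix (Fin 2) (Fin 2) ℝ :=
  Matrix.of fun i j => dot (fderiv ℝ x p (coordVec i)) (fderiv ℝ x p (coordVec j))

/-- The matrix of the second fundamental form with respect to the unit normal `n` at `p`. The second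
derivative of `x` in `L^{2,2}` differs from the one in `H^{2,1}` by a multiple of `x p`, which is
orthogonal to `n`. -/
def secondForm (x : ℝ × ℝ → L22) (n : L22) (p : ℝ × ℝ) : Matrix (Fin 2) (Fin 2) ℝ :=
  Matrix.of fun i j =>
    dot (fderiv ℝ (fun q => fderiv ℝ x q (coordVec j)) p (coordVec i)) n

/-- The mean curvature with respect to the unit normal `n` at `p`: half the trace of the second
fundamental form with respect to the first. In an orthonormal frame `e₁, e₂` of the tangent plane
with `⟨e₁, e₁⟩ = 1`, `⟨e₂, e₂⟩ = -1` this is `(h₁₁ - h₂₂) / 2`. -/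
def meanCurvature (x : ℝ × ℝ → L22) (n : L22) (p : ℝ × ℝ) : ℝ :=
  ((firstForm x p)⁻¹ * secondForm x n p).trace / 2

end

end AntiDeSitter

/-! Write `C = cosh r`, `S = sinh r`, and `v`, `u` for the geodesic velocities at the two ends.
Geodesics satisfy `γ'' = γ`, so `x'` and `u` are hyperbolic combinations of `x` and `v`. Since the
projections are null, `v = N + ε e₃` and `u = N' + ε' e₃'`. Parallel transport changes only the
velocity component, so the transport condition says exactly that `⟨N, N'⟩` is the constant `b = -h
C`. Thus `x, v, N, N'` is a moving frame with constant Gram matrix, nondegenerate because `h ≠ 0`.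

Differentiating the frame leaves five one-forms: `⟨dx,v⟩`, `⟨dx,N'⟩`, `⟨dv,N⟩`, `⟨dv,N'⟩`,
`⟨dN,N'⟩`. Tangency of the second surface gives a linear relation among them; symmetry of the two
second fundamental forms gives two quadratic ones. The form `⟨dN,N'⟩` cancels from the sum of these
two (`shape_trace_eq`), and what remains determines the trace: the mean curvature for `v - N` is
`(2C + b)/(2S)` (`meanCurvature_of_frame`). Reversing the geodesics exchanges the surfaces. -/

namespace AntiDeSitter

/-! ### Algebra and calculus of the indefinite inner product. -/

section Dot

lemma dot_comm (a b : L22) : dot a b = dot b a := by simp only [dot]; ring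

lemma dot_add_left (a b c : L22) : dot (a + b) c = dot a c + dot b c := by
  simp only [dot, Pi.add_apply]; ring

lemma dot_add_right (a b c : L22) : dot a (b + c) = dot a b + dot a c := by
  simp only [dot, Pi.add_apply]; ring

lemma dot_sub_left (a b c : L22) : dot (a - b) c = dot a c - dot b c := by
  simp only [dot, Pi.sub_apply]; ring

lemma dot_sub_right (a b c : L22) : dot a (b - c) = dot a b - dot a c := by
  simp only [dot, Pi.sub_apply]; ring

lemma dot_neg_left (a b : L22) : dot (-a) b = -dot a b := by
  simp only [dot, Pi.neg_apply]; ring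

lemma dot_neg_right (a b : L22) : dot a (-b) = -dot a b := by
  simp only [dot, Pi.neg_apply]; ring

lemma dot_smul_left (s : ℝ) (a b : L22) : dot (s • a) b = s * dot a b := by
  simp only [dot, Pi.smul_apply, smul_eq_mul]; ring

lemma dot_smul_right (s : ℝ) (a b : L22) : dot a (s • b) = s * dot a b := by
  simp only [dot, Pi.smul_apply, smul_eq_mul]; ring

variable {E : Type*} [NormedAddCommGroup E] [NormedSpace ℝ E]

lemma differentiableAt_dot {f g : E → L22} {p : E} (hf : DifferentiableAt ℝ f p)
    (hg : DifferentiableAt ℝ g p) : DifferentiableAt ℝ (fun q => dot (f q) (g q)) p := by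
  rw [differentiableAt_pi] at hf hg
  exact ((((hf 0).mul (hg 0)).add ((hf 1).mul (hg 1))).sub ((hf 2).mul (hg 2))).sub
    ((hf 3).mul (hg 3))

lemma fderiv_dot {f g : E → L22} {p : E} (hf : DifferentiableAt ℝ f p)
    (hg : DifferentiableAt ℝ g p) (c : E) :
    fderiv ℝ (fun q => dot (f q) (g q)) p c =
      dot (fderiv ℝ f p c) (g p) + dot (f p) (fderiv ℝ g p c) := by
  have kf := hasFDerivAt_pi'.1 hf.hasFDerivAt
  have kg := hasFDerivAt_pi'.1 hg.hasFDerivAt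
  have key := ((((kf 0).mul (kg 0)).add ((kf 1).mul (kg 1))).sub ((kf 2).mul (kg 2))).sub
    ((kf 3).mul (kg 3))
  have : HasFDerivAt (fun q => dot (f q) (g q)) _ p := key
  rw [this.fderiv]
  simp [dot]
  ring

lemma fderiv_dot_of_eventually_const {f g : E → L22} {p : E} (hf : DifferentiableAt ℝ f p)
    (hg : DifferentiableAt ℝ g p) {k : ℝ} (h : ∀ᶠ q in nhds p, dot (f q) (g q) = k) (c : E) :
    dot (fderiv ℝ f p c) (g p) + dot (f p) (fderiv ℝ g p c) = 0 := by
  rw [← fderiv_dot hf hg, Filter.EventuallyEq.fderiv_eq (f := fun _ => k) h]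
  simp

lemma hasDerivAt_dot {f g : ℝ → L22} {t : ℝ} {f' g' : L22} (hf : HasDerivAt f f' t)
    (hg : HasDerivAt g g' t) :
    HasDerivAt (fun s => dot (f s) (g s)) (dot f' (g t) + dot (f t) g') t := by
  have h := (differentiableAt_dot hf.differentiableAt hg.differentiableAt).hasDerivAt
  rwa [← fderiv_apply_one_eq_deriv, fderiv_dot hf.differentiableAt hg.differentiableAt,
    fderiv_apply_one_eq_deriv, fderiv_apply_one_eq_deriv, hf.deriv, hg.deriv] at h

/-- A vector orthogonal to four vectors with invertible Gram matrix vanishes. -/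
lemma eq_zero_of_dot_eq_zero (F : Fin 4 → L22)
    (hF : (Matrix.of fun i j => dot (F i) (F j)).det ≠ 0) {y : L22}
    (hy : ∀ i, dot (F i) y = 0) : y = 0 := by
  set A : Matrix (Fin 4) (Fin 4) ℝ := Matrix.of F * Matrix.diagonal ![1, 1, -1, -1]
  have hA (u : L22) (i : Fin 4) : (A.mulVec u) i = dot (F i) u := by
    simp [A, Matrix.mulVec, dotProduct, Fin.sum_univ_four, Matrix.mul_apply, dot,
      Matrix.diagonal_apply]
    ring
  -- The Gram matrix factors through `A`, so its invertibility passes to `A`, whose rows represent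
  -- the functionals `dot (F i)`.
  have hG : (Matrix.of fun i j => dot (F i) (F j)) = A * (Matrix.of F).transpose := by
    ext i j
    have := hA (F j) i
    simp only [Matrix.of_apply]
    rw [← this]
    rfl
  have hdet : A.det ≠ 0 := by
    intro h
    rw [hG, Matrix.det_mul, h, zero_mul] at hF
    exact hF rfl
  exact Matrix.eq_zero_of_mulVec_eq_zero hdet (funext fun i => by rw [hA, hy]; rfl)

/-- Expansion of the inner product in a frame with a unit timelike, a unit spacelike and two null
vectors. -/
lemma dot_eq_of_frame {x v N N' : L22} {b : ℝ} (hb : b ≠ 0)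
    (hxx : dot x x = -1) (hxv : dot x v = 0) (hvv : dot v v = 1)
    (hxN : dot x N = 0) (hxN' : dot x N' = 0) (hvN : dot v N = 0) (hvN' : dot v N' = 0)
    (hNN : dot N N = 0) (hN'N' : dot N' N' = 0) (hNN' : dot N N' = b) (a c : L22) :
    dot a c = -(dot a x * dot c x) + dot a v * dot c v +
      (dot a N * dot c N' + dot a N' * dot c N) / b := by
  have key : a - (-(dot a x) • x + dot a v • v + (dot a N' / b) • N + (dot a N / b) • N') = 0 := by
    refine eq_zero_of_dot_eq_zero ![x, v, N, N'] ?_ ?_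
    -- The null pair forms a hyperbolic block, so the Gram determinant is `b ^ 2`.
    · have : (Matrix.of fun i j => dot (![x, v, N, N'] i) (![x, v, N, N'] j)) =
          !![-1, 0, 0, 0; 0, 1, 0, 0; 0, 0, 0, b; 0, 0, b, 0] := by
        ext i j
        fin_cases i <;> fin_cases j <;>
          simp [hxx, hxv, hvv, hxN, hxN', hvN, hvN', hNN, hN'N', hNN', dot_comm v x, dot_comm N x,
            dot_comm N v, dot_comm N' x, dot_comm N' v, dot_comm N' N]
      rw [this]
      simp [Matrix.det_succ_row_zero, Fin.sum_univ_succ, Fin.succAbove, hb]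
    · intro i
      fin_cases i <;>
        simp only [Fin.zero_eta, Fin.mk_one, Fin.reduceFinMk, Matrix.cons_val, dot_sub_right,
          dot_add_right, dot_smul_right, dot_comm v x, dot_comm N x,
            dot_comm N v, dot_comm N' x, dot_comm N' v, dot_comm N' N,
            hxx, hxv, hvv, hxN, hxN', hvN, hvN', hNN, hN'N', hNN', dot_comm _ a] <;>
        field_simp <;> ring
  have hc : dot (a - (-(dot a x) • x + dot a v • v + (dot a N' / b) • N + (dot a N / b) • N')) c
      = 0 := by
    rw [key]
    simp [dot]
  simp only [dot_sub_left, dot_add_left, dot_smul_left] at hc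
  rw [dot_comm c x, dot_comm c v, dot_comm c N, dot_comm c N', sub_eq_zero.1 hc]
  field_simp
  ring

end Dot

/-! ### Geodesics and parallel transport in closed form. -/

section Curves

lemma IsSpacelikeGeodesic.hasDerivAt {γ : ℝ → L22} (hγ : IsSpacelikeGeodesic γ) (t : ℝ) :
    HasDerivAt γ (deriv γ t) t :=
  (hγ.smooth.differentiable (by simp) t).hasDerivAt

lemma IsSpacelikeGeodesic.dot_deriv {γ : ℝ → L22} (hγ : IsSpacelikeGeodesic γ) (t : ℝ) :
    dot (γ t) (deriv γ t) = 0 := by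
  have h := hasDerivAt_dot (hγ.hasDerivAt t) (hγ.hasDerivAt t)
  have h2 : HasDerivAt (fun s => dot (γ s) (γ s)) 0 t := by
    rw [show (fun s => dot (γ s) (γ s)) = fun _ => (-1 : ℝ) from funext hγ.mem]
    exact hasDerivAt_const t _
  have := h.unique h2
  rw [dot_comm] at this
  linarith

/-- Differentiating `⟨γ, γ'⟩ = 0` with unit speed gives `⟨γ'', γ⟩ = -1`, which turns the geodesic
equation into `γ'' = γ`. -/
lemma IsSpacelikeGeodesic.hasDerivAt_deriv {γ : ℝ → L22} (hγ : IsSpacelikeGeodesic γ) (t : ℝ) :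
    HasDerivAt (deriv γ) (γ t) t := by
  have hd : HasDerivAt (deriv γ) (deriv (deriv γ) t) t :=
    ((contDiff_infty_iff_deriv.1 hγ.smooth).2.differentiable (by simp) t).hasDerivAt
  have h := hasDerivAt_dot (hγ.hasDerivAt t) hd
  have h2 : HasDerivAt (fun s => dot (γ s) (deriv γ s)) 0 t := by
    rw [show (fun s => dot (γ s) (deriv γ s)) = fun _ => (0 : ℝ) from funext hγ.dot_deriv]
    exact hasDerivAt_const t _
  have h3 := h.unique h2
  rw [hγ.unit_speed, dot_comm] at h3
  have h4 := hγ.geodesic t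
  rw [covDeriv, show dot (deriv (deriv γ) t) (γ t) = -1 by linarith, neg_one_smul,
    ← sub_eq_add_neg, sub_eq_zero] at h4
  rwa [h4] at hd

/-- Spacelike geodesics are hyperbolas in planes through the origin. -/
lemma IsSpacelikeGeodesic.eq {γ : ℝ → L22} (hγ : IsSpacelikeGeodesic γ) (r : ℝ) :
    γ r = Real.cosh r • γ 0 + Real.sinh r • deriv γ 0 ∧
      deriv γ r = Real.sinh r • γ 0 + Real.cosh r • deriv γ 0 := by
  have hA (t : ℝ) : HasDerivAt (fun s => Real.cosh s • γ s - Real.sinh s • deriv γ s) 0 t := by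
    refine (((Real.hasDerivAt_cosh t).smul (hγ.hasDerivAt t)).sub
      ((Real.hasDerivAt_sinh t).smul (hγ.hasDerivAt_deriv t))).congr_deriv ?_
    module
  have hB (t : ℝ) : HasDerivAt (fun s => Real.cosh s • deriv γ s - Real.sinh s • γ s) 0 t := by
    refine (((Real.hasDerivAt_cosh t).smul (hγ.hasDerivAt_deriv t)).sub
      ((Real.hasDerivAt_sinh t).smul (hγ.hasDerivAt t))).congr_deriv ?_
    module
  have eA := is_const_of_deriv_eq_zero (fun t => (hA t).differentiableAt) (fun t => (hA t).deriv) 0 r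
  have eB := is_const_of_deriv_eq_zero (fun t => (hB t).differentiableAt) (fun t => (hB t).deriv) 0 r
  simp only [Real.cosh_zero, Real.sinh_zero, one_smul, zero_smul, sub_zero] at eA eB
  have hcs := Real.cosh_sq_sub_sinh_sq r
  rw [eA, eB]
  constructor
  · ext i
    simp only [Pi.add_apply, Pi.sub_apply, Pi.smul_apply, smul_eq_mul]
    linear_combination -(γ r i) * hcs
  · ext i
    simp only [Pi.add_apply, Pi.sub_apply, Pi.smul_apply, smul_eq_mul]
    linear_combination -(deriv γ r i) * hcs

/-- Parallel transport along a spacelike geodesic fixes the part orthogonal to the velocity. -/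
lemma IsParallelTransport.eq {γ : ℝ → L22} (hγ : IsSpacelikeGeodesic γ) {a b : ℝ} {v w : L22}
    (h : IsParallelTransport γ a b v w) :
    w = v + dot v (deriv γ a) • (deriv γ b - deriv γ a) := by
  obtain ⟨V, hV, rfl, rfl⟩ := h
  have hd0 (t : ℝ) : HasDerivAt V (deriv V t) t :=
    (hV.smooth.differentiable (by simp) t).hasDerivAt
  have hd (t : ℝ) : HasDerivAt V (dot (V t) (deriv γ t) • γ t) t := by
    have h1 := hasDerivAt_dot (hd0 t) (hγ.hasDerivAt t)
    have h2 : HasDerivAt (fun s => dot (V s) (γ s)) 0 t := by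
      rw [show (fun s => dot (V s) (γ s)) = fun _ => (0 : ℝ) from funext hV.tangent]
      exact hasDerivAt_const t _
    have h3 := h1.unique h2
    have h4 := hV.parallel t
    rw [covDeriv, show dot (deriv V t) (γ t) = -dot (V t) (deriv γ t) by linarith, neg_smul,
      ← sub_eq_add_neg, sub_eq_zero] at h4
    rw [← h4]
    exact hd0 t
  have hc (t : ℝ) : HasDerivAt (fun s => dot (V s) (deriv γ s)) 0 t := by
    convert hasDerivAt_dot (hd t) (hγ.hasDerivAt_deriv t) using 1
    rw [dot_smul_left, hγ.dot_deriv, hV.tangent]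
    ring
  have ec (t : ℝ) : dot (V t) (deriv γ t) = dot (V a) (deriv γ a) :=
    is_const_of_deriv_eq_zero (fun t => (hc t).differentiableAt) (fun t => (hc t).deriv) t a
  -- Here `V' = c γ` with `c = ⟨V, γ'⟩` constant, and `γ = γ''`, so `V - c γ'` is constant.
  have hD (t : ℝ) : HasDerivAt (fun s => V s - dot (V a) (deriv γ a) • deriv γ s) 0 t := by
    refine ((hd t).sub
      ((hγ.hasDerivAt_deriv t).const_smul (dot (V a) (deriv γ a)))).congr_deriv ?_
    rw [ec, sub_self]
  have eD : V b - dot (V a) (deriv γ a) • deriv γ b = V a - dot (V a) (deriv γ a) • deriv γ a :=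
    is_const_of_deriv_eq_zero (fun t => (hD t).differentiableAt) (fun t => (hD t).deriv) b a
  rw [sub_eq_iff_eq_add] at eD
  rw [eD, smul_sub]
  abel

end Curves

/-! ### Timelike surfaces, projections and unit normals. -/

section Surfaces

lemma fderiv_eq_coordVec (x : ℝ × ℝ → L22) (p c : ℝ × ℝ) :
    fderiv ℝ x p c = c.1 • fderiv ℝ x p (coordVec 0) + c.2 • fderiv ℝ x p (coordVec 1) := by
  rw [← map_smul, ← map_smul, ← map_add]
  congr 1
  ext <;> simp [coordVec]

variable {U : Set (ℝ × ℝ)} {x : ℝ × ℝ → L22} {p : ℝ × ℝ}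

lemma det_firstForm (x : ℝ × ℝ → L22) (p : ℝ × ℝ) : (firstForm x p).det =
    dot (fderiv ℝ x p (coordVec 0)) (fderiv ℝ x p (coordVec 0)) *
      dot (fderiv ℝ x p (coordVec 1)) (fderiv ℝ x p (coordVec 1)) -
    dot (fderiv ℝ x p (coordVec 0)) (fderiv ℝ x p (coordVec 1)) ^ 2 := by
  rw [Matrix.det_fin_two]
  simp only [firstForm, Matrix.of_apply]
  rw [dot_comm (fderiv ℝ x p (coordVec 1)) (fderiv ℝ x p (coordVec 0))]
  ring

lemma IsTimelikeImmersion.det_firstForm_neg (hx : IsTimelikeImmersion U x) (hp : p ∈ U) :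
    (firstForm x p).det < 0 := by
  obtain ⟨u, hu⟩ := hx.exists_pos p hp
  obtain ⟨w, hw⟩ := hx.exists_neg p hp
  rw [fderiv_eq_coordVec] at hu hw
  rw [det_firstForm]
  set X := fderiv ℝ x p (coordVec 0)
  set Y := fderiv ℝ x p (coordVec 1)
  simp only [dot_add_left, dot_add_right, dot_smul_left, dot_smul_right, dot_comm Y X] at hu hw
  by_contra! h
  set a := dot X X
  set b := dot X Y
  set c := dot Y Y
  -- Completing the square: with nonnegative determinant, `a` and `c` times any value of the form
  -- are nonnegative. As the form takes both signs, `a = c = 0`, hence `b = 0`, a contradiction.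
  have h1 (s t : ℝ) : a * (s * (s * a + t * b) + t * (s * b + t * c)) =
      (s * a + t * b) ^ 2 + t ^ 2 * (a * c - b ^ 2) := by ring
  have h2 (s t : ℝ) : c * (s * (s * a + t * b) + t * (s * b + t * c)) =
      (s * b + t * c) ^ 2 + s ^ 2 * (a * c - b ^ 2) := by ring
  have q (s t : ℝ) : 0 ≤ (s * a + t * b) ^ 2 + t ^ 2 * (a * c - b ^ 2) := by positivity
  have q' (s t : ℝ) : 0 ≤ (s * b + t * c) ^ 2 + s ^ 2 * (a * c - b ^ 2) := by positivity
  have ha : 0 ≤ a := by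
    by_contra! ha
    nlinarith [h1 u.1 u.2, q u.1 u.2]
  have ha' : a ≤ 0 := by
    by_contra! ha
    nlinarith [h1 w.1 w.2, q w.1 w.2]
  have hc : 0 ≤ c := by
    by_contra! hc
    nlinarith [h2 u.1 u.2, q' u.1 u.2]
  have hc' : c ≤ 0 := by
    by_contra! hc
    nlinarith [h2 w.1 w.2, q' w.1 w.2]
  have ea : a = 0 := le_antisymm ha' ha
  have ec : c = 0 := le_antisymm hc' hc
  have eb : b = 0 := by
    rw [ea, ec] at h
    nlinarith
  rw [ea, eb, ec] at hu
  simp at hu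

/-- The orthogonal projection to the tangent plane in terms of the first fundamental form. -/
lemma IsOrthProj.eq {v w : L22} (hw : IsOrthProj (tangentPlane x p) v w)
    (hdet : (firstForm x p).det ≠ 0) :
    w = (firstForm x p).det⁻¹ •
      ((dot (fderiv ℝ x p (coordVec 1)) (fderiv ℝ x p (coordVec 1)) *
          dot v (fderiv ℝ x p (coordVec 0)) -
        dot (fderiv ℝ x p (coordVec 0)) (fderiv ℝ x p (coordVec 1)) *
          dot v (fderiv ℝ x p (coordVec 1))) • fderiv ℝ x p (coordVec 0) +
      (dot (fderiv ℝ x p (coordVec 0)) (fderiv ℝ x p (coordVec 0)) *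
          dot v (fderiv ℝ x p (coordVec 1)) -
        dot (fderiv ℝ x p (coordVec 0)) (fderiv ℝ x p (coordVec 1)) *
          dot v (fderiv ℝ x p (coordVec 0))) • fderiv ℝ x p (coordVec 1)) := by
  obtain ⟨⟨c, rfl⟩, h⟩ := hw
  have h0 := h _ ⟨coordVec 0, rfl⟩
  have h1 := h _ ⟨coordVec 1, rfl⟩
  simp only [ContinuousLinearMap.coe_coe] at h0 h1 ⊢
  rw [fderiv_eq_coordVec] at h0 h1 ⊢
  rw [eq_inv_smul_iff₀ hdet]
  rw [det_firstForm]
  set X := fderiv ℝ x p (coordVec 0)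
  set Y := fderiv ℝ x p (coordVec 1)
  simp only [dot_add_left, dot_sub_left, dot_smul_left, dot_comm Y X] at h0 h1
  rw [sub_eq_zero] at h0 h1
  rw [h0, h1]
  module

lemma differentiableAt_fderiv_apply {x : ℝ × ℝ → L22} (hx : ContDiffAt ℝ ∞ x p) (c : ℝ × ℝ) :
    DifferentiableAt ℝ (fun q => fderiv ℝ x q c) p :=
  ((hx.fderiv_right (m := ∞) (by simp)).differentiableAt (by simp)).clm_apply
    (differentiableAt_const c)

lemma fderiv_fderiv_comm {x : ℝ × ℝ → L22} (hx : ContDiffAt ℝ ∞ x p) (c d : ℝ × ℝ) :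
    fderiv ℝ (fun q => fderiv ℝ x q c) p d = fderiv ℝ (fun q => fderiv ℝ x q d) p c := by
  have hd : DifferentiableAt ℝ (fderiv ℝ x) p :=
    (hx.fderiv_right (m := ∞) (by simp)).differentiableAt (by simp)
  rw [fderiv_clm_apply hd (differentiableAt_const c), fderiv_clm_apply hd (differentiableAt_const d)]
  have := (hx.isSymmSndFDerivAt (by
    rw [minSmoothness_of_isRCLikeNormedField]; exact ENat.LEInfty.out)) c d
  simpa using this.symm

lemma IsTimelikeImmersion.contDiffAt (hx : IsTimelikeImmersion U x) (hU : IsOpen U) (hp : p ∈ U) :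
    ContDiffAt ℝ ∞ x p :=
  hx.smooth.contDiffAt (hU.mem_nhds hp)

/-- The projection is given only pointwise; Cramer's rule in the coordinate basis supplies its
regularity. -/
lemma IsTimelikeImmersion.differentiableAt_orthProj (hx : IsTimelikeImmersion U x) (hU : IsOpen U)
    (hp : p ∈ U) {v N : ℝ × ℝ → L22} (hv : DifferentiableAt ℝ v p)
    (hN : ∀ q ∈ U, IsOrthProj (tangentPlane x q) (v q) (N q)) : DifferentiableAt ℝ N p := by
  have hX := differentiableAt_fderiv_apply (hx.contDiffAt hU hp) (coordVec 0)
  have hY := differentiableAt_fderiv_apply (hx.contDiffAt hU hp) (coordVec 1)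
  have hdet : DifferentiableAt ℝ (fun q => (firstForm x q).det) p := by
    simp only [det_firstForm]
    exact ((differentiableAt_dot hX hX).mul (differentiableAt_dot hY hY)).sub ((differentiableAt_dot hX hY).pow 2)
  refine DifferentiableAt.congr_of_eventuallyEq ?_
    (Filter.eventually_of_mem (hU.mem_nhds hp) fun q hq =>
      (hN q hq).eq (hx.det_firstForm_neg hq).ne)
  exact (hdet.inv (hx.det_firstForm_neg hp).ne).smul
    (((((differentiableAt_dot hY hY).mul (differentiableAt_dot hv hX)).sub ((differentiableAt_dot hX hY).mul (differentiableAt_dot hv hY))).smul hX).add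
      ((((differentiableAt_dot hX hX).mul (differentiableAt_dot hv hY)).sub ((differentiableAt_dot hX hY).mul (differentiableAt_dot hv hX))).smul hY))

lemma IsTimelikeImmersion.dot_fderiv_self (hx : IsTimelikeImmersion U x) (hU : IsOpen U)
    (hp : p ∈ U) (c : ℝ × ℝ) : dot (fderiv ℝ x p c) (x p) = 0 := by
  have hd := (hx.contDiffAt hU hp).differentiableAt (by simp)
  have h := fderiv_dot_of_eventually_const hd hd
    (Filter.eventually_of_mem (hU.mem_nhds hp) hx.mem) c
  rw [dot_comm (x p)] at h
  linarith

lemma IsOrthProj.dot_fderiv {v w : L22} (hw : IsOrthProj (tangentPlane x p) v w) (c : ℝ × ℝ) :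
    dot (fderiv ℝ x p c) (v - w) = 0 := by
  rw [dot_comm]
  exact hw.2 _ ⟨c, rfl⟩

/-- A unit vector with null projection to the tangent plane is the sum of this projection and a unit
normal. -/
lemma IsTimelikeImmersion.eq_add_normal (hx : IsTimelikeImmersion U x) (hU : IsOpen U)
    (hp : p ∈ U) {v w n : L22} (hn : IsUnitNormal x p n)
    (hw : IsOrthProj (tangentPlane x p) v w) (hww : dot w w = 0) (hvv : dot v v = 1)
    (hxv : dot (x p) v = 0) {ε : ℝ} (hε : ε = 1 ∨ ε = -1) (hpos : 0 < ε * dot v n) :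
    v = w + ε • n := by
  obtain ⟨c, hc⟩ := hw.1
  have hwx : dot (x p) w = 0 := by
    rw [dot_comm, ← hc]
    exact hx.dot_fderiv_self hU hp c
  have hnw : dot n w = 0 := hn.normal w hw.1
  have key : v - w - dot v n • n = 0 := by
    refine eq_zero_of_dot_eq_zero
      ![x p, n, fderiv ℝ x p (coordVec 0), fderiv ℝ x p (coordVec 1)] ?_ ?_
    · have h1 (d : ℝ × ℝ) := hx.dot_fderiv_self hU hp d
      have h2 (d : ℝ × ℝ) : dot n (fderiv ℝ x p d) = 0 := hn.normal _ ⟨d, rfl⟩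
      have : (Matrix.of fun i j =>
          dot (![x p, n, fderiv ℝ x p (coordVec 0), fderiv ℝ x p (coordVec 1)] i)
            (![x p, n, fderiv ℝ x p (coordVec 0), fderiv ℝ x p (coordVec 1)] j)) =
          !![-1, 0, 0, 0; 0, 1, 0, 0;
            0, 0, firstForm x p 0 0, firstForm x p 0 1;
            0, 0, firstForm x p 1 0, firstForm x p 1 1] := by
        have hxx : dot (x p) (x p) = -1 := hx.mem p hp
        ext i j
        fin_cases i <;> fin_cases j <;>
          simp [firstForm, h1, h2, hn.tangent, hn.unit, hxx, dot_comm (x p),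
            dot_comm (fderiv ℝ x p _) n]
      rw [this]
      have hd := (hx.det_firstForm_neg hp).ne
      rw [Matrix.det_fin_two] at hd
      simp [Matrix.det_succ_row_zero, Fin.sum_univ_succ, Fin.succAbove]
      intro h
      exact hd (by linarith)
    · have h1 (d : ℝ × ℝ) : dot (fderiv ℝ x p d) (v - w - dot v n • n) = 0 := by
        have h2 : dot n (fderiv ℝ x p d) = 0 := hn.normal _ ⟨d, rfl⟩
        rw [dot_sub_right, hw.dot_fderiv, dot_smul_right, dot_comm (fderiv ℝ x p d) n, h2]
        simp
      intro i
      fin_cases i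
      · simp [dot_sub_right, dot_smul_right, hxv, hwx, dot_comm (x p) n, hn.tangent]
      · simp [dot_sub_right, dot_smul_right, hnw, hn.unit, dot_comm n v]
      · exact h1 _
      · exact h1 _
  have hv : v = w + dot v n • n := by
    rw [sub_sub, sub_eq_zero] at key
    exact key
  -- The null part `w` contributes nothing to `⟨v, v⟩ = 1`.
  have hsq : dot v n ^ 2 = 1 := by
    rw [hv] at hvv
    simp only [dot_add_left, dot_add_right, dot_smul_left, dot_smul_right, hww, hnw, hn.unit,
      dot_comm w n] at hvv
    linarith
  have : dot v n = ε := by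
    rcases hε with rfl | rfl <;> rcases eq_or_eq_neg_of_sq_eq_sq _ _ (hsq.trans (one_pow 2).symm) with h | h <;>
      first | exact h | (rw [h] at hpos; norm_num at hpos)
  rwa [this] at hv

lemma meanCurvature_smul (x : ℝ × ℝ → L22) (s : ℝ) (n : L22) (p : ℝ × ℝ) :
    meanCurvature x (s • n) p = s * meanCurvature x n p := by
  have : secondForm x (s • n) p = s • secondForm x n p := by
    ext i j
    simp [secondForm, dot_smul_right]
  rw [meanCurvature, meanCurvature, this, Matrix.mul_smul, Matrix.trace_smul, smul_eq_mul,
    mul_div_assoc]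

end Surfaces

/-! ### Mean curvature from a moving frame. -/

section MeanCurvature

variable {x : ℝ × ℝ → L22} {p : ℝ × ℝ}

/-- The derivative of a normal field is the negative shape operator. -/
lemma dot_fderiv_fderiv_of_normal (hx : ContDiffAt ℝ ∞ x p) {n : ℝ × ℝ → L22}
    (hn : DifferentiableAt ℝ n p)
    (h : ∀ᶠ q in nhds p, ∀ c, dot (fderiv ℝ x q c) (n q) = 0) (c d : ℝ × ℝ) :
    dot (fderiv ℝ (fun q => fderiv ℝ x q c) p d) (n p) =
      -dot (fderiv ℝ x p c) (fderiv ℝ n p d) := by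
  have := fderiv_dot_of_eventually_const (differentiableAt_fderiv_apply hx c) hn
    (h.mono fun q hq => hq c) d
  linarith

/-- Mixed partials of `x` commute. Applied to both surfaces, this is the only second-order
information about them that the elimination needs. -/
lemma dot_fderiv_normal_comm (hx : ContDiffAt ℝ ∞ x p) {n : ℝ × ℝ → L22}
    (hn : DifferentiableAt ℝ n p)
    (h : ∀ᶠ q in nhds p, ∀ c, dot (fderiv ℝ x q c) (n q) = 0) (c d : ℝ × ℝ) :
    dot (fderiv ℝ x p c) (fderiv ℝ n p d) = dot (fderiv ℝ x p d) (fderiv ℝ n p c) := by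
  have h1 := dot_fderiv_fderiv_of_normal hx hn h c d
  have h2 := dot_fderiv_fderiv_of_normal hx hn h d c
  rw [fderiv_fderiv_comm hx] at h1
  linarith

lemma meanCurvature_eq (hx : ContDiffAt ℝ ∞ x p) {n : ℝ × ℝ → L22}
    (hn : DifferentiableAt ℝ n p)
    (h : ∀ᶠ q in nhds p, ∀ c, dot (fderiv ℝ x q c) (n q) = 0) :
    meanCurvature x (n p) p = -(firstForm x p).det⁻¹ *
      (dot (fderiv ℝ x p (coordVec 1)) (fderiv ℝ x p (coordVec 1)) *
          dot (fderiv ℝ x p (coordVec 0)) (fderiv ℝ n p (coordVec 0)) -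
        2 * (dot (fderiv ℝ x p (coordVec 0)) (fderiv ℝ x p (coordVec 1)) *
          dot (fderiv ℝ x p (coordVec 0)) (fderiv ℝ n p (coordVec 1))) +
        dot (fderiv ℝ x p (coordVec 0)) (fderiv ℝ x p (coordVec 0)) *
          dot (fderiv ℝ x p (coordVec 1)) (fderiv ℝ n p (coordVec 1))) / 2 := by
  rw [meanCurvature, Matrix.inv_def, Ring.inverse_eq_inv', Matrix.adjugate_fin_two]
  simp only [Matrix.trace_fin_two, Matrix.mul_apply, Fin.sum_univ_two, Matrix.smul_apply,
    Matrix.of_apply, Matrix.cons_val_zero, Matrix.cons_val_one, Matrix.cons_val', smul_eq_mul,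
    firstForm, secondForm, dot_fderiv_fderiv_of_normal hx hn h,
    dot_fderiv_normal_comm hx hn h (coordVec 1) (coordVec 0),
    dot_comm (fderiv ℝ x p (coordVec 1)) (fderiv ℝ x p (coordVec 0))]
  simp
  ring

/-- Elimination of the connection forms of a null frame adapted to both surfaces. -/
lemma shape_trace_eq {b C S s₁ s₂ a₁ a₂ r₁ r₂ d₁ d₂ w₁ w₂ : ℝ}
    (hCS : C ^ 2 - S ^ 2 = 1) (h₁ : s₁ = C * a₁ + S * d₁) (h₂ : s₂ = C * a₂ + S * d₂)
    (hA : (d₁ * s₂ - d₂ * s₁) + (r₁ * a₂ - r₂ * a₁) + b * (r₁ * s₂ - r₂ * s₁) -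
      (w₁ * s₂ - w₂ * s₁) = 0)
    (hB : (C ^ 2 - S ^ 2) * ((d₁ * s₂ - d₂ * s₁) + (r₁ * a₂ - r₂ * a₁)) +
      b * C * (d₁ * s₂ - d₂ * s₁) + C * (w₁ * a₂ - w₂ * a₁) + b * S * (a₁ * s₂ - a₂ * s₁) +
      S * (w₁ * d₂ - w₂ * d₁) = 0) :
    S * (2 * (r₁ * a₂ - r₂ * a₁) + b * (r₁ * s₂ - r₂ * s₁)) =
      (2 * C + b) * (a₁ * s₂ - a₂ * s₁) := by
  have hw : C * (w₁ * a₂ - w₂ * a₁) + S * (w₁ * d₂ - w₂ * d₁) = w₁ * s₂ - w₂ * s₁ := by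
    rw [h₁, h₂]; ring
  have hd : S * (d₁ * s₂ - d₂ * s₁) = -C * (a₁ * s₂ - a₂ * s₁) := by
    rw [h₁, h₂]; ring
  rw [hCS] at hB
  linear_combination S * hA + S * hB - S * hw - (2 + b * C) * hd +
    b * (a₁ * s₂ - a₂ * s₁) * hCS

/-- The mean curvature of `x` with respect to the normal `v - N`, where `v` is the velocity of the
joining geodesics, from a frame `x, v, N, N'` with constant inner products. -/
theorem meanCurvature_of_frame {v y u N N' : ℝ × ℝ → L22} {b C S : ℝ} (hb : b ≠ 0) (hS : S ≠ 0)
    (hCS : C ^ 2 - S ^ 2 = 1) (hx : ContDiffAt ℝ ∞ x p) (hv : ContDiffAt ℝ ∞ v p)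
    (hN : DifferentiableAt ℝ N p) (hN' : DifferentiableAt ℝ N' p)
    (hdet : (firstForm x p).det ≠ 0)
    (hxx : ∀ᶠ q in nhds p, dot (x q) (x q) = -1) (hxv : ∀ᶠ q in nhds p, dot (x q) (v q) = 0)
    (hvv : ∀ᶠ q in nhds p, dot (v q) (v q) = 1) (hxN : ∀ᶠ q in nhds p, dot (x q) (N q) = 0)
    (hxN' : ∀ᶠ q in nhds p, dot (x q) (N' q) = 0) (hvN : ∀ᶠ q in nhds p, dot (v q) (N q) = 0)
    (hvN' : ∀ᶠ q in nhds p, dot (v q) (N' q) = 0) (hNN : ∀ᶠ q in nhds p, dot (N q) (N q) = 0)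
    (hN'N' : ∀ᶠ q in nhds p, dot (N' q) (N' q) = 0)
    (hNN' : ∀ᶠ q in nhds p, dot (N q) (N' q) = b)
    (htan : ∀ᶠ q in nhds p, ∀ c, dot (fderiv ℝ x q c) (v q - N q) = 0)
    (hy : ∀ᶠ q in nhds p, y q = C • x q + S • v q) (hu : ∀ᶠ q in nhds p, u q = S • x q + C • v q)
    (hytan : ∀ᶠ q in nhds p, ∀ c, dot (fderiv ℝ y q c) (u q - N' q) = 0) :
    meanCurvature x (v p - N p) p = (2 * C + b) / (2 * S) := by
  have dx : DifferentiableAt ℝ x p := hx.differentiableAt (by simp)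
  have dv : DifferentiableAt ℝ v p := hv.differentiableAt (by simp)
  have htan' : ∀ᶠ q in nhds p, ∀ c, dot (fderiv ℝ (fun q => C • x q + S • v q) q c)
      (S • x q + C • v q - N' q) = 0 := by
    filter_upwards [hytan, hu, hy.eventually_nhds] with q h1 h2 h3 c
    rw [← h2, ← Filter.EventuallyEq.fderiv_eq h3]
    exact h1 c
  have cy : ContDiffAt ℝ ∞ (fun q => C • x q + S • v q) p :=
    (hx.const_smul C).add (hv.const_smul S)
  have ey (c : ℝ × ℝ) : fderiv ℝ (fun q => C • x q + S • v q) p c =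
      C • fderiv ℝ x p c + S • fderiv ℝ v p c := by
    change fderiv ℝ (C • x + S • v) p c = _
    rw [((dx.hasFDerivAt.const_smul C).add (dv.hasFDerivAt.const_smul S)).fderiv]
    rfl
  have hn : DifferentiableAt ℝ (fun q => v q - N q) p := dv.sub hN
  have en (c : ℝ × ℝ) : fderiv ℝ (fun q => v q - N q) p c = fderiv ℝ v p c - fderiv ℝ N p c := by
    change fderiv ℝ (v - N) p c = _
    rw [(dv.hasFDerivAt.sub hN.hasFDerivAt).fderiv]
    rfl
  have hn' : DifferentiableAt ℝ (fun q => S • x q + C • v q - N' q) p :=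
    ((dx.const_smul S).add (dv.const_smul C)).sub hN'
  have en' (c : ℝ × ℝ) : fderiv ℝ (fun q => S • x q + C • v q - N' q) p c =
      S • fderiv ℝ x p c + C • fderiv ℝ v p c - fderiv ℝ N' p c := by
    change fderiv ℝ (S • x + C • v - N') p c = _
    rw [(((dx.hasFDerivAt.const_smul S).add (dv.hasFDerivAt.const_smul C)).sub
      hN'.hasFDerivAt).fderiv]
    rfl
  have expand := dot_eq_of_frame hb hxx.self_of_nhds hxv.self_of_nhds hvv.self_of_nhds
    hxN.self_of_nhds hxN'.self_of_nhds hvN.self_of_nhds hvN'.self_of_nhds hNN.self_of_nhds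
    hN'N'.self_of_nhds hNN'.self_of_nhds
  have symA := dot_fderiv_normal_comm hx hn htan (coordVec 1) (coordVec 0)
  have symB := dot_fderiv_normal_comm cy hn' htan' (coordVec 1) (coordVec 0)
  rw [meanCurvature_eq hx hn htan]
  rw [det_firstForm] at hdet ⊢
  simp only [ey, en, en'] at symA symB ⊢
  -- Constancy of the Gram matrix and tangency of `x` reduce all derivative coefficients to five
  -- one-forms.
  have xx (c : ℝ × ℝ) : dot (fderiv ℝ x p c) (x p) = 0 := by
    have := fderiv_dot_of_eventually_const dx dx hxx c
    rw [dot_comm (x p)] at this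
    linarith
  have vx (c : ℝ × ℝ) : dot (fderiv ℝ v p c) (x p) = -dot (fderiv ℝ x p c) (v p) := by
    have := fderiv_dot_of_eventually_const dx dv hxv c
    rw [dot_comm (x p)] at this
    linarith
  have vv (c : ℝ × ℝ) : dot (fderiv ℝ v p c) (v p) = 0 := by
    have := fderiv_dot_of_eventually_const dv dv hvv c
    rw [dot_comm (v p)] at this
    linarith
  have xN (c : ℝ × ℝ) : dot (fderiv ℝ x p c) (N p) = dot (fderiv ℝ x p c) (v p) := by
    have := htan.self_of_nhds c
    rw [dot_sub_right] at this
    linarith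
  have Nx (c : ℝ × ℝ) : dot (fderiv ℝ N p c) (x p) = -dot (fderiv ℝ x p c) (v p) := by
    have := fderiv_dot_of_eventually_const dx hN hxN c
    rw [dot_comm (x p), xN] at this
    linarith
  have N'x (c : ℝ × ℝ) : dot (fderiv ℝ N' p c) (x p) = -dot (fderiv ℝ x p c) (N' p) := by
    have := fderiv_dot_of_eventually_const dx hN' hxN' c
    rw [dot_comm (x p)] at this
    linarith
  have Nv (c : ℝ × ℝ) : dot (fderiv ℝ N p c) (v p) = -dot (fderiv ℝ v p c) (N p) := by
    have := fderiv_dot_of_eventually_const dv hN hvN c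
    rw [dot_comm (v p)] at this
    linarith
  have N'v (c : ℝ × ℝ) : dot (fderiv ℝ N' p c) (v p) = -dot (fderiv ℝ v p c) (N' p) := by
    have := fderiv_dot_of_eventually_const dv hN' hvN' c
    rw [dot_comm (v p)] at this
    linarith
  have NN (c : ℝ × ℝ) : dot (fderiv ℝ N p c) (N p) = 0 := by
    have := fderiv_dot_of_eventually_const hN hN hNN c
    rw [dot_comm (N p)] at this
    linarith
  have N'N' (c : ℝ × ℝ) : dot (fderiv ℝ N' p c) (N' p) = 0 := by
    have := fderiv_dot_of_eventually_const hN' hN' hN'N' c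
    rw [dot_comm (N' p)] at this
    linarith
  have N'N (c : ℝ × ℝ) : dot (fderiv ℝ N' p c) (N p) = -dot (fderiv ℝ N p c) (N' p) := by
    have := fderiv_dot_of_eventually_const hN hN' hNN' c
    rw [dot_comm (N p)] at this
    linarith
  -- This is `⟨dy, u⟩ = ⟨dy, N'⟩`, whose left side equals `(C² - S²)⟨dx, v⟩`.
  have hs (c : ℝ × ℝ) : dot (fderiv ℝ x p c) (v p) =
      C * dot (fderiv ℝ x p c) (N' p) + S * dot (fderiv ℝ v p c) (N' p) := by
    have := htan'.self_of_nhds c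
    rw [ey] at this
    simp only [dot_add_left, dot_sub_right, dot_add_right, dot_smul_left, dot_smul_right, xx, vx,
      vv] at this
    linear_combination this - dot (fderiv ℝ x p c) (v p) * hCS
  have h₁ := hs (coordVec 0)
  have h₂ := hs (coordVec 1)
  simp only [dot_add_left, dot_sub_right, dot_add_right, dot_smul_left, dot_smul_right,
    expand (fderiv ℝ _ p _) (fderiv ℝ _ p _), xx, vx, vv, xN, Nx, N'x, Nv, N'v, NN, N'N', N'N]
    at symA symB hdet ⊢
  generalize dot (fderiv ℝ x p (coordVec 0)) (v p) = s₁ at *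
  generalize dot (fderiv ℝ x p (coordVec 1)) (v p) = s₂ at *
  generalize dot (fderiv ℝ x p (coordVec 0)) (N' p) = a₁ at *
  generalize dot (fderiv ℝ x p (coordVec 1)) (N' p) = a₂ at *
  generalize dot (fderiv ℝ v p (coordVec 0)) (N p) = r₁ at *
  generalize dot (fderiv ℝ v p (coordVec 1)) (N p) = r₂ at *
  generalize dot (fderiv ℝ v p (coordVec 0)) (N' p) = d₁ at *
  generalize dot (fderiv ℝ v p (coordVec 1)) (N' p) = d₂ at *
  generalize dot (fderiv ℝ N p (coordVec 0)) (N' p) = w₁ at *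
  generalize dot (fderiv ℝ N p (coordVec 1)) (N' p) = w₂ at *
  field_simp at symA symB
  -- `hA` and `hB` are the symmetry of the second fundamental forms of `x` and of `y`, in frame
  -- coefficients.
  have hA : (d₁ * s₂ - d₂ * s₁) + (r₁ * a₂ - r₂ * a₁) + b * (r₁ * s₂ - r₂ * s₁) -
      (w₁ * s₂ - w₂ * s₁) = 0 := by
    linear_combination symA
  have hB : (C ^ 2 - S ^ 2) * ((d₁ * s₂ - d₂ * s₁) + (r₁ * a₂ - r₂ * a₁)) +
      b * C * (d₁ * s₂ - d₂ * s₁) + C * (w₁ * a₂ - w₂ * a₁) + b * S * (a₁ * s₂ - a₂ * s₁) +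
      S * (w₁ * d₂ - w₂ * d₁) = 0 := by
    linear_combination symB
  have key := shape_trace_eq hCS h₁ h₂ hA hB
  have solve {D M : ℝ} (hD : D ≠ 0) (hM : S * M = -(2 * C + b) * D) :
      -D⁻¹ * M / 2 = (2 * C + b) / (2 * S) := by
    field_simp
    linear_combination -hM
  -- In the frame the determinant is `-(s₁ a₂ - s₂ a₁)² / b²`, so `key` enters multiplied by that
  -- wedge; `hA` corrects for keeping a single off-diagonal entry in the trace.
  refine solve hdet ?_
  field_simp
  linear_combination -(s₁ * a₂ - s₂ * a₁) * key +
    S * (b * s₁ * s₂ + s₁ * a₂ + a₁ * s₂ + (s₁ * a₂ - s₂ * a₁)) * hA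

end MeanCurvature

end AntiDeSitter

/-! ### Verification of the frame hypotheses for both surfaces. -/

open AntiDeSitter Filter in
theorem mainTheorem3 (U : Set (ℝ × ℝ)) (hU : IsOpen U)
    -- the two surfaces and their unit normals
    (x x' : ℝ × ℝ → AntiDeSitter.L22)
    (hx : AntiDeSitter.IsTimelikeImmersion U x)
    (hx' : AntiDeSitter.IsTimelikeImmersion U x')
    (e₃ e₃' : ℝ × ℝ → AntiDeSitter.L22)
    (he₃ : ∀ p ∈ U, AntiDeSitter.IsUnitNormal x p (e₃ p))
    (he₃' : ∀ p ∈ U, AntiDeSitter.IsUnitNormal x' p (e₃' p))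
    -- (i) corresponding points are joined by a spacelike geodesic of fixed length
    (r : ℝ) (hr : 0 < r)
    (γ : ℝ × ℝ → ℝ → AntiDeSitter.L22)
    (hγ : ∀ p ∈ U, AntiDeSitter.IsSpacelikeGeodesic (γ p))
    (hγ_start : ∀ p ∈ U, γ p 0 = x p)
    (hγ_end : ∀ p ∈ U, γ p r = x' p)
    -- (ii) the tangents at both ends project to null vectors of the tangent planes
    (N N' : ℝ × ℝ → AntiDeSitter.L22)
    (hN : ∀ p ∈ U,
      AntiDeSitter.IsOrthProj (AntiDeSitter.tangentPlane x p) (deriv (γ p) 0) (N p))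
    (hN' : ∀ p ∈ U,
      AntiDeSitter.IsOrthProj (AntiDeSitter.tangentPlane x' p) (deriv (γ p) r) (N' p))
    (hN_null : ∀ p ∈ U, AntiDeSitter.IsNull (N p))
    (hN'_null : ∀ p ∈ U, AntiDeSitter.IsNull (N' p))
    -- the signs that record on which side of each surface its unit normal lies
    (ε ε' : ℝ) (hε : ε = 1 ∨ ε = -1) (hε' : ε' = 1 ∨ ε' = -1)
    (hside : ∀ p ∈ U, 0 < ε * AntiDeSitter.dot (deriv (γ p) 0) (e₃ p))
    (hside' : ∀ p ∈ U, 0 < ε' * AntiDeSitter.dot (deriv (γ p) r) (e₃' p))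
    -- (iii) the transported normal has constant inner product with the null vector
    (h : ℝ) (hh : h ≠ 0)
    (hpair : ∀ p ∈ U, ∃ w, AntiDeSitter.IsParallelTransport (γ p) 0 r (e₃ p) w ∧
      AntiDeSitter.dot w (ε • N' p) = h * Real.cosh r) :
    (∀ p ∈ U, AntiDeSitter.meanCurvature x (e₃ p) p = ε * ((2 - h) / (2 * Real.tanh r))) ∧
    (∀ p ∈ U, AntiDeSitter.meanCurvature x' (e₃' p) p = -ε' * ((2 - h) / (2 * Real.tanh r))) := by
  have hS : Real.sinh r ≠ 0 := (Real.sinh_pos_iff.2 hr).ne'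
  have hC : Real.cosh r ≠ 0 := (Real.cosh_pos r).ne'
  have hCS := Real.cosh_sq_sub_sinh_sq r
  have hb : -(h * Real.cosh r) ≠ 0 := neg_ne_zero.2 (mul_ne_zero hh hC)
  have hεε : ε * ε = 1 := by rcases hε with rfl | rfl <;> norm_num
  have hεε' : ε' * ε' = 1 := by rcases hε' with rfl | rfl <;> norm_num
  have htanh : (2 * Real.cosh r + -(h * Real.cosh r)) / (2 * Real.sinh r) =
      (2 - h) / (2 * Real.tanh r) := by
    rw [Real.tanh_eq_sinh_div_cosh]
    field_simp
    ring
  set v : ℝ × ℝ → L22 := fun q => deriv (γ q) 0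
  set u : ℝ × ℝ → L22 := fun q => deriv (γ q) r
  rw [Real.tanh_eq_sinh_div_cosh] at htanh ⊢
  set C := Real.cosh r
  set S := Real.sinh r
  have near {P : ℝ × ℝ → Prop} (hP : ∀ q ∈ U, P q) {p : ℝ × ℝ} (hp : p ∈ U) : ∀ᶠ q in nhds p, P q :=
    eventually_of_mem (hU.mem_nhds hp) hP
  have hx'_eq : ∀ q ∈ U, x' q = C • x q + S • v q := fun q hq => by
    rw [← hγ_end q hq, ← hγ_start q hq]
    exact ((hγ q hq).eq r).1
  have hu_eq : ∀ q ∈ U, u q = S • x q + C • v q := fun q hq => by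
    rw [← hγ_start q hq]
    exact ((hγ q hq).eq r).2
  have hx_eq : ∀ q ∈ U, x q = C • x' q - S • u q := fun q hq => by
    calc x q = (C ^ 2 - S ^ 2) • x q := by rw [hCS, one_smul]
      _ = _ := by rw [hx'_eq q hq, hu_eq q hq]; module
  have hv_eq : ∀ q ∈ U, v q = C • u q - S • x' q := fun q hq => by
    calc v q = (C ^ 2 - S ^ 2) • v q := by rw [hCS, one_smul]
      _ = _ := by rw [hx'_eq q hq, hu_eq q hq]; module
  have xx : ∀ q ∈ U, dot (x q) (x q) = -1 := hx.mem
  have xx' : ∀ q ∈ U, dot (x' q) (x' q) = -1 := hx'.mem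
  have vv : ∀ q ∈ U, dot (v q) (v q) = 1 := fun q hq => (hγ q hq).unit_speed 0
  have uu : ∀ q ∈ U, dot (u q) (u q) = 1 := fun q hq => (hγ q hq).unit_speed r
  have xv : ∀ q ∈ U, dot (x q) (v q) = 0 := fun q hq => by
    rw [← hγ_start q hq]
    exact (hγ q hq).dot_deriv 0
  have xu' : ∀ q ∈ U, dot (x' q) (u q) = 0 := fun q hq => by
    rw [← hγ_end q hq]
    exact (hγ q hq).dot_deriv r
  have hv_add : ∀ q ∈ U, v q = N q + ε • e₃ q := fun q hq =>
    hx.eq_add_normal hU hq (he₃ q hq) (hN q hq) (hN_null q hq).2 (vv q hq) (xv q hq) hε (hside q hq)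
  have hu_add : ∀ q ∈ U, u q = N' q + ε' • e₃' q := fun q hq =>
    hx'.eq_add_normal hU hq (he₃' q hq) (hN' q hq) (hN'_null q hq).2 (uu q hq) (xu' q hq) hε'
      (hside' q hq)
  have he_eq : ∀ q ∈ U, e₃ q = ε • (v q - N q) := fun q hq => by
    rw [hv_add q hq, add_sub_cancel_left, smul_smul, hεε, one_smul]
  have he_eq' : ∀ q ∈ U, e₃' q = -ε' • (-u q - -N' q) := fun q hq => by
    rw [hu_add q hq, neg_sub_neg, sub_add_cancel_left, smul_neg, neg_smul, neg_neg, smul_smul, hεε',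
      one_smul]
  have vN : ∀ q ∈ U, dot (v q) (N q) = 0 := fun q hq => by
    rw [hv_add q hq, dot_add_left, dot_smul_left, (hN_null q hq).2,
      (he₃ q hq).normal _ (hN q hq).1]
    ring
  have uN' : ∀ q ∈ U, dot (u q) (N' q) = 0 := fun q hq => by
    rw [hu_add q hq, dot_add_left, dot_smul_left, (hN'_null q hq).2,
      (he₃' q hq).normal _ (hN' q hq).1]
    ring
  have xN : ∀ q ∈ U, dot (x q) (N q) = 0 := fun q hq => by
    obtain ⟨c, hc⟩ := (hN q hq).1
    rw [dot_comm, ← hc]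
    exact hx.dot_fderiv_self hU hq c
  have xN' : ∀ q ∈ U, dot (x' q) (N' q) = 0 := fun q hq => by
    obtain ⟨c, hc⟩ := (hN' q hq).1
    rw [dot_comm, ← hc]
    exact hx'.dot_fderiv_self hU hq c
  have NN' : ∀ q ∈ U, dot (N q) (N' q) = -(h * C) := fun q hq => by
    obtain ⟨w, hw, hpw⟩ := hpair q hq
    have hev : dot (e₃ q) (v q) = ε := by
      rw [hv_add q hq, dot_add_right, dot_smul_right, (he₃ q hq).normal _ (hN q hq).1,
        (he₃ q hq).unit]
      ring
    have hw' : w = e₃ q + ε • (u q - v q) := by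
      rw [← hev]
      exact hw.eq (hγ q hq)
    have hsub : dot (N q) (N' q) = dot (v q) (N' q) - ε * dot (e₃ q) (N' q) := by
      rw [hv_add q hq, dot_add_left, dot_smul_left]
      ring
    -- Transport gives `w = e₃ + ε (u - v)`, and `u ⊥ N'`, so `⟨w, ε N'⟩ = -⟨v - ε e₃, N'⟩ = -⟨N,
    -- N'⟩`.
    rw [hw', dot_smul_right, dot_add_left, dot_smul_left, dot_sub_left, uN' q hq] at hpw
    rw [hsub]
    linear_combination -hpw - dot (v q) (N' q) * hεε
  have cx {p : ℝ × ℝ} (hp : p ∈ U) := hx.contDiffAt hU hp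
  have cx' {p : ℝ × ℝ} (hp : p ∈ U) := hx'.contDiffAt hU hp
  -- No smooth dependence of `γ p` on `p` is assumed; smoothness of `v` comes from `v = S⁻¹ (x' - C
  -- x)`.
  have cv {p : ℝ × ℝ} (hp : p ∈ U) : ContDiffAt ℝ ∞ v p := by
    refine ContDiffAt.congr_of_eventuallyEq
      (((cx' hp).sub ((cx hp).const_smul C)).const_smul S⁻¹)
      (near (fun q hq => ?_) hp)
    simp [hx'_eq q hq, smul_smul, hS]
  have cu {p : ℝ × ℝ} (hp : p ∈ U) : ContDiffAt ℝ ∞ u p :=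
    ContDiffAt.congr_of_eventuallyEq
      (((cx hp).const_smul S).add ((cv hp).const_smul C))
      (near hu_eq hp)
  have dN {p : ℝ × ℝ} (hp : p ∈ U) : DifferentiableAt ℝ N p :=
    hx.differentiableAt_orthProj hU hp ((cv hp).differentiableAt (by simp)) hN
  have dN' {p : ℝ × ℝ} (hp : p ∈ U) : DifferentiableAt ℝ N' p :=
    hx'.differentiableAt_orthProj hU hp ((cu hp).differentiableAt (by simp)) hN'
  constructor
  · intro p hp
    rw [he_eq p hp, meanCurvature_smul, ← htanh, meanCurvature_of_frame (y := x') (u := u) hb hS hCS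
      (cx hp) (cv hp) (dN hp) (dN' hp) (hx.det_firstForm_neg hp).ne (near xx hp) (near xv hp)
      (near vv hp) (near xN hp) (near (fun q hq => ?_) hp) (near vN hp) (near (fun q hq => ?_) hp)
      (near (fun q hq => (hN_null q hq).2) hp) (near (fun q hq => (hN'_null q hq).2) hp)
      (near NN' hp) (near (fun q hq => (hN q hq).dot_fderiv) hp) (near hx'_eq hp) (near hu_eq hp)
      (near (fun q hq => (hN' q hq).dot_fderiv) hp)]
    · rw [hx_eq q hq, dot_sub_left, dot_smul_left, dot_smul_left, xN' q hq, uN' q hq]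
      ring
    · rw [hv_eq q hq, dot_sub_left, dot_smul_left, dot_smul_left, xN' q hq, uN' q hq]
      ring
  · intro p hp
    -- Reversed geodesics start at `x'` with velocity `-u` and projections `-N'`, `-N`, so `b` is
    -- unchanged. The resulting normal `-u + N'` is `-ε' e₃'`, hence the opposite sign.
    rw [he_eq' p hp, meanCurvature_smul, ← htanh, meanCurvature_of_frame (v := fun q => -u q)
      (N := fun q => -N' q) (N' := fun q => -N q) (y := x) (u := fun q => -v q) hb hS hCS
      (cx' hp) (cu hp).neg (dN' hp).neg (dN hp).neg (hx'.det_firstForm_neg hp).ne (near xx' hp)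
      (near (fun q hq => ?_) hp) (near (fun q hq => ?_) hp) (near (fun q hq => ?_) hp)
      (near (fun q hq => ?_) hp) (near (fun q hq => ?_) hp) (near (fun q hq => ?_) hp)
      (near (fun q hq => ?_) hp) (near (fun q hq => ?_) hp) (near (fun q hq => ?_) hp)
      (near (fun q hq c => ?_) hp) (near (fun q hq => ?_) hp) (near (fun q hq => ?_) hp)
      (near (fun q hq c => ?_) hp)]
    · rw [dot_neg_right, xu' q hq, neg_zero]
    · rw [dot_neg_left, dot_neg_right, uu q hq, neg_neg]
    · rw [dot_neg_right, xN' q hq, neg_zero]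
    · rw [hx'_eq q hq, dot_neg_right, dot_add_left, dot_smul_left, dot_smul_left, xN q hq, vN q hq]
      ring
    · rw [dot_neg_left, dot_neg_right, uN' q hq, neg_neg]
    · rw [hu_eq q hq, dot_neg_left, dot_neg_right, dot_add_left, dot_smul_left, dot_smul_left,
        xN q hq, vN q hq]
      ring
    · rw [dot_neg_left, dot_neg_right, (hN'_null q hq).2, neg_neg]
    · rw [dot_neg_left, dot_neg_right, (hN_null q hq).2, neg_neg]
    · rw [dot_neg_left, dot_neg_right, dot_comm, NN' q hq, neg_neg]
    · rw [neg_sub_neg, ← neg_sub, dot_neg_right, (hN' q hq).dot_fderiv, neg_zero]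
    · rw [smul_neg, ← sub_eq_add_neg, hx_eq q hq]
    · rw [hv_eq q hq]
      module
    · rw [neg_sub_neg, ← neg_sub, dot_neg_right, (hN q hq).dot_fderiv, neg_zero]
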